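/- Let $X=\{0,1\}^{\mathbb Z}$ carry the metric $d(x,y)=\sum_{i\in\mathbb Z}\delta(x_i,y_i)2^{-|i|}$, where $\delta(a,b)=1$ if $a\ne b$ and $\delta(a,b)=0$ if $a=b$. For a local function $f:\{0,1\}^3\to\{0,1\}$, the elementary cellular automaton (ECA) with local function $f$ is the map $F:X\to X$, $F(x)_i=f(x_{i-1},x_i,x_{i+1})$. The rule number of $f$ is the integer in $\{0,\dots,255\}$ whose binary expansion is $f(111)f(110)f(101)f(100)f(011)f(010)f(001)f(000)$. Two rules are called equivalent if one is obtained from the other by the left/right exchange $f(a,b,c)\mapsto f(c,b,a)$, the $0/1$ complementation $f(a,b,c)\mapsto 1-f(1-a,1-b,1-c)$, or their composition; each equivalence class is named by the lowest rule number in it. A map $F:X\to X$ is chaotic in the sense of Devaney if it is sensitive (there is $\epsilon>0$ such that for all $x\in X$ and $\delta>0$ there are $y\in X$ with $d(x,y)<\delta$ and $n\ge 0$ with $d(F^n(x),F^n(y))\ge\epsilon$), transitive (for all nonempty open $U,V\subseteq X$ there is $n>0$ with $F^n(U)\cap V\ne\emptyset$), and the set of its periodic points (those $x$ with $F^n(x)=x$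 for some $n>0$) is dense in $X$. **Statement.** An ECA is chaotic in the sense of Devaney if and only if its rule belongs to one of the equivalence classes named $$15,\ 30,\ 45,\ 60,\ 90,\ 105,\ 106,\ 150,\ 154,\ 170.$$ -/

import Mathlib

/-! ### Topological dynamics of a self-map of a metric space -/

/-- Sensitivity to initial conditions. -/
def IsSensitive {X : Type*} [MetricSpace X] (F : X → X) : Prop :=
  ∃ ε > (0 : ℝ), ∀ x : X, ∀ δ > (0 : ℝ), ∃ y : X, dist x y < δ ∧
    ∃ n : ℕ, ε ≤ dist (F^[n] x) (F^[n] y)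

/-- Topological transitivity of a map. -/
def IsTransitiveMap {X : Type*} [TopologicalSpace X] (F : X → X) : Prop :=
  ∀ U V : Set X, IsOpen U → IsOpen V → U.Nonempty → V.Nonempty →
    ∃ n : ℕ, 0 < n ∧ ((F^[n] '' U) ∩ V).Nonempty

/-- Chaos in the sense of Devaney: sensitive, transitive, and with a dense set of periodic points
(`Function.periodicPts F` is the set of `x` with `F^[n] x = x` for some `n > 0`). -/
def IsDevaneyChaotic {X : Type*} [MetricSpace X] (F : X → X) : Prop :=
  IsSensitive F ∧ IsTransitiveMap F ∧ Dense (Function.periodicPts F)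

namespace ECA

/-! ### The configuration space -/

/-- Bi-infinite sequences over the state set `{0, 1}` (`false` is 0, `true` is 1). -/
def Config : Type := ℤ → Bool

namespace Config

/-- The term of index `i` in the metric: `δ(xᵢ, yᵢ) / 2^|i|`, with `δ` the discrete metric. -/
noncomputable def distTerm (x y : Config) (i : ℤ) : ℝ :=
  (if x i ≠ y i then 1 else 0) / 2 ^ i.natAbs

theorem distTerm_nonneg (x y : Config) (i : ℤ) : 0 ≤ distTerm x y i := by
  unfold distTerm; split_ifs <;> positivity

theorem summable_distTerm (x y : Config) : Summable (distTerm x y) := by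
  have hg : Summable (fun i : ℤ => ((1 : ℝ) / 2) ^ i.natAbs) := by
    apply Summable.of_nat_of_neg <;> simpa using summable_geometric_two
  refine Summable.of_nonneg_of_le (distTerm_nonneg x y) (fun i => ?_) hg
  unfold distTerm
  rw [div_pow, one_pow]
  gcongr
  split_ifs <;> norm_num

/-- The metric `d(x, y) = ∑_{i ∈ ℤ} δ(xᵢ, yᵢ) / 2^|i|`; the topology is the one it induces. -/
noncomputable instance : MetricSpace Config where
  dist x y := ∑' i : ℤ, distTerm x y i
  dist_self x := by simp [distTerm]
  dist_comm x y := by simp only [distTerm, ne_comm]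
  dist_triangle x y z := by
    rw [← (summable_distTerm x y).tsum_add (summable_distTerm y z)]
    refine (summable_distTerm x z).tsum_le_tsum (fun i => ?_)
      ((summable_distTerm x y).add (summable_distTerm y z))
    unfold distTerm
    rw [← add_div]
    gcongr
    by_cases h1 : x i = y i <;> by_cases h2 : y i = z i <;> by_cases h3 : x i = z i <;>
      simp_all
  eq_of_dist_eq_zero {x y} h := by
    funext i
    by_contra hne
    have hpos : 0 < distTerm x y i := by
      unfold distTerm; rw [if_pos hne]; positivity
    exact absurd h (((summable_distTerm x y).tsum_pos (distTerm_nonneg x y) i hpos).ne')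

theorem dist_def (x y : Config) :
    dist x y = ∑' i : ℤ, (if x i ≠ y i then (1 : ℝ) else 0) / 2 ^ i.natAbs := rfl

end Config

/-! ### Elementary cellular automata -/

/-- A local function `f : {0,1}³ → {0,1}`; its arguments are the states of the left neighbour, of
the cell itself and of the right neighbour. -/
abbrev LocalRule : Type := Bool → Bool → Bool → Bool

/-- The elementary cellular automaton `F(x)ᵢ = f(xᵢ₋₁, xᵢ, xᵢ₊₁)`. -/
def globalMap (f : LocalRule) : Config → Config :=
  fun x i => f (x (i - 1)) (x i) (x (i + 1))

/-- The Wolfram number: the values `f(111) f(110) … f(001) f(000)` read as a binary number. -/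
def wolframNumber (f : LocalRule) : ℕ :=
  ∑ a : Bool, ∑ b : Bool, ∑ c : Bool,
    (f a b c).toNat * 2 ^ (4 * a.toNat + 2 * b.toNat + c.toNat)

/-- The symmetry exchanging left and right. -/
def reflect (f : LocalRule) : LocalRule := fun a b c => f c b a

/-- The symmetry exchanging the states 0 and 1. -/
def complement (f : LocalRule) : LocalRule := fun a b c => !(f (!a) (!b) (!c))

/-- The symmetry group of a rule, i.e. its equivalence class under left/right reflection and 0/1
complementation (these are commuting involutions), is referred to by the lowest Wolfram number
occurring in it. -/
def classNumber (f : LocalRule) : ℕ :=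
  min (min (wolframNumber f) (wolframNumber (reflect f)))
    (min (wolframNumber (complement f)) (wolframNumber (complement (reflect f))))

end ECA

namespace ECA

/-! ### The metric and the reflection of configurations -/

namespace Config

/-! The listed classes consist of rules permutive in the right or the left argument; mirroring is an
isometry conjugating the two cases. Under a right permutive rule the leftmost difference of two
configurations moves left one cell per step, which gives sensitivity and lets a target word be
prescribed far to the right, hence transitivity. For periodic points, space-time is sheared so that
three adjacent columns determine all others in both directions; on time-periodic columns this is a
permutation of a finite set, so it has finite order (`RightPermutive.slantedOrbit_mem_periodicPts`).
Every other rule either has an orphan, hence is not transitive, or is the identity or cellwise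
complementation, an isometry, hence not sensitive. A finite check (`classNumber_mem_or`) shows that
nothing else occurs. -/

theorem le_dist_of_ne {x y : Config} {i : ℤ} (h : x i ≠ y i) :
    (1 : ℝ) / 2 ^ i.natAbs ≤ dist x y := by
  have := (summable_distTerm x y).le_tsum i (fun j _ => distTerm_nonneg x y j)
  rw [distTerm, if_pos h] at this
  exact this

theorem exists_dist_lt {ε : ℝ} (hε : 0 < ε) :
    ∃ m : ℕ, ∀ x y : Config, (∀ i : ℤ, i.natAbs ≤ m → x i = y i) → dist x y < ε := by
  have hg : Summable (fun i : ℤ => (1 : ℝ) / 2 ^ i.natAbs) := by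
    apply Summable.of_nat_of_neg <;> simpa using summable_geometric_two
  obtain ⟨s, hs⟩ := ((tendsto_order.1
    (tendsto_tsum_compl_atTop_zero (fun i : ℤ => (1 : ℝ) / 2 ^ i.natAbs))).2 ε hε).exists
  refine ⟨s.sup Int.natAbs, fun x y h => lt_of_le_of_lt ?_ hs⟩
  have hzero : ∀ i ∈ s, distTerm x y i = 0 := fun i hi => by
    simp [distTerm, h i (Finset.le_sup (f := Int.natAbs) hi)]
  have hsum := (summable_distTerm x y).sum_add_tsum_compl (s := s)
  rw [Finset.sum_eq_zero hzero, zero_add] at hsum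
  change ∑' i, distTerm x y i ≤ _
  rw [← hsum]
  refine Summable.tsum_le_tsum (fun i => ?_) ((summable_distTerm x y).subtype _) (hg.subtype _)
  simp only [distTerm]
  gcongr
  split_ifs <;> norm_num

theorem exists_agree_subset {U : Set Config} (hU : IsOpen U) {x : Config} (hx : x ∈ U) :
    ∃ m : ℕ, ∀ y : Config, (∀ i : ℤ, i.natAbs ≤ m → y i = x i) → y ∈ U := by
  obtain ⟨ε, hε, hball⟩ := Metric.isOpen_iff.1 hU x hx
  obtain ⟨m, hm⟩ := exists_dist_lt hε
  exact ⟨m, fun y hy => hball (hm y x hy)⟩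

theorem isOpen_agree (x : Config) (m : ℕ) :
    IsOpen {y : Config | ∀ i : ℤ, i.natAbs ≤ m → y i = x i} := by
  refine Metric.isOpen_iff.2 fun y hy => ⟨1 / 2 ^ m, by positivity, fun z hz i hi => ?_⟩
  rw [← hy i hi]
  by_contra hne
  have h1 := le_dist_of_ne hne
  have h2 : (1 : ℝ) / 2 ^ m ≤ 1 / 2 ^ i.natAbs := by gcongr; norm_num
  exact absurd (Metric.mem_ball.1 hz) (not_lt.2 (h2.trans h1))

/-- The configuration read from right to left. -/
def mirror (x : Config) : Config := fun i => x (-i)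

theorem mirror_mirror (x : Config) : x.mirror.mirror = x := by
  funext i
  simp [mirror]

theorem dist_mirror (x y : Config) : dist x.mirror y.mirror = dist x y := by
  rw [dist_def, dist_def, ← (Equiv.neg ℤ).tsum_eq]
  refine tsum_congr fun i => ?_
  simp [mirror]

theorem continuous_mirror : Continuous mirror :=
  (Isometry.of_dist_eq dist_mirror).continuous

end Config

open Config

theorem globalMap_reflect_mirror (f : LocalRule) (x : Config) :
    globalMap (reflect f) x.mirror = (globalMap f x).mirror := by
  funext i
  simp only [globalMap, reflect, Config.mirror]
  congr 2 <;> ring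

theorem iterate_globalMap_reflect_mirror (f : LocalRule) (n : ℕ) (x : Config) :
    (globalMap (reflect f))^[n] x.mirror = ((globalMap f)^[n] x).mirror :=
  (Function.Semiconj.iterate_right
    (fun x => (globalMap_reflect_mirror f x).symm : Function.Semiconj Config.mirror _ _) n x).symm

theorem isDevaneyChaotic_of_reflect {f : LocalRule}
    (h : IsDevaneyChaotic (globalMap (reflect f))) : IsDevaneyChaotic (globalMap f) := by
  obtain ⟨⟨ε, hε, hs⟩, ht, hd⟩ := h
  have hit (n : ℕ) (x : Config) :
      (globalMap f)^[n] x.mirror = ((globalMap (reflect f))^[n] x).mirror :=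
    iterate_globalMap_reflect_mirror (reflect f) n x
  refine ⟨⟨ε, hε, fun x δ hδ => ?_⟩, fun U V hU hV ⟨u, hu⟩ ⟨v, hv⟩ => ?_, ?_⟩
  · obtain ⟨y, hy, n, hn⟩ := hs x.mirror δ hδ
    refine ⟨y.mirror, ?_, n, ?_⟩
    · rwa [← dist_mirror, mirror_mirror]
    · rwa [hit, ← dist_mirror, mirror_mirror, ← iterate_globalMap_reflect_mirror]
  · obtain ⟨n, hn, _, ⟨x, hx, rfl⟩, hxV⟩ := ht _ _ (hU.preimage continuous_mirror)
      (hV.preimage continuous_mirror) ⟨u.mirror, by simpa [mirror_mirror] using hu⟩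
      ⟨v.mirror, by simpa [mirror_mirror] using hv⟩
    exact ⟨n, hn, _, ⟨x.mirror, hx, rfl⟩, by rw [hit]; exact hxV⟩
  · refine dense_iff_inter_open.2 fun U hU ⟨u, hu⟩ => ?_
    obtain ⟨x, hxU, n, hn, hx⟩ := hd.inter_open_nonempty _ (hU.preimage continuous_mirror)
      ⟨u.mirror, by simpa [mirror_mirror] using hu⟩
    refine ⟨x.mirror, hxU, n, hn, ?_⟩
    rw [Function.IsPeriodicPt, Function.IsFixedPt, hit, hx]

/-! ### Right permutive rules -/

/-- A rule that is a bijection in its right argument. -/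
def RightPermutive (f : LocalRule) : Prop := ∀ a b, f a b true ≠ f a b false

theorem RightPermutive.apply {f : LocalRule} (hf : RightPermutive f) (a b c : Bool) :
    f a b c = xor c (f a b false) := by
  have := hf a b
  revert this
  cases c <;> cases f a b true <;> cases f a b false <;> simp

theorem iterate_eq_of_lt (f : LocalRule) {x y : Config} {N : ℤ} (h : ∀ i < N, x i = y i)
    (n : ℕ) : ∀ i < N - n, (globalMap f)^[n] x i = (globalMap f)^[n] y i := by
  induction n with
  | zero => simpa using h
  | succ n ih =>
    intro i hi
    push_cast at hi
    simp only [Function.iterate_succ_apply', globalMap]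
    rw [ih (i - 1) (by omega), ih i (by omega), ih (i + 1) (by omega)]

/-- At the cell just left of the leftmost difference, only the right argument differs, and the rule
is injective in it. -/
theorem RightPermutive.iterate_ne {f : LocalRule} (hf : RightPermutive f) {x y : Config} {N : ℤ}
    (h : ∀ i < N, x i = y i) (hN : x N ≠ y N) (n : ℕ) :
    (globalMap f)^[n] x (N - n) ≠ (globalMap f)^[n] y (N - n) := by
  induction n with
  | zero => simpa using hN
  | succ n ih =>
    have hlt := iterate_eq_of_lt f h n
    simp only [Function.iterate_succ_apply', globalMap]
    push_cast
    rw [hlt (N - (n + 1) - 1) (by omega), hlt (N - (n + 1)) (by omega),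
      show N - ((n : ℤ) + 1) + 1 = N - n by ring, hf.apply _ _ ((globalMap f)^[n] x (N - n)),
      hf.apply _ _ ((globalMap f)^[n] y (N - n))]
    simpa using ih

/-- The configuration with the state of the cell `N` exchanged. -/
def toggle (x : Config) (N : ℤ) : Config := fun i => if i = N then !(x i) else x i

theorem toggle_of_ne (x : Config) {N i : ℤ} (h : i ≠ N) : toggle x N i = x i := if_neg h

theorem toggle_self (x : Config) (N : ℤ) : toggle x N N = !(x N) := if_pos rfl

theorem RightPermutive.iterate_toggle {f : LocalRule} (hf : RightPermutive f) (x : Config)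
    (N : ℤ) (n : ℕ) :
    (globalMap f)^[n] x (N - n) ≠ (globalMap f)^[n] (toggle x N) (N - n) :=
  hf.iterate_ne (fun _ hi => (toggle_of_ne x hi.ne).symm) (by simp [toggle_self]) n

theorem RightPermutive.isSensitive {f : LocalRule} (hf : RightPermutive f) :
    IsSensitive (globalMap f) := by
  refine ⟨1, one_pos, fun x δ hδ => ?_⟩
  obtain ⟨m, hm⟩ := exists_dist_lt hδ
  -- The first cell outside the window; its change reaches cell 0, of weight 1, after `m + 1` steps.
  refine ⟨toggle x (m + 1 : ℕ), hm _ _ fun i hi => (toggle_of_ne x (by omega)).symm, m + 1, ?_⟩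
  have h := hf.iterate_toggle x (m + 1 : ℕ) (m + 1)
  rw [sub_self] at h
  simpa using le_dist_of_ne h

/-- The target is corrected from left to right: toggling cell `a + L` flips the image at `a + L - n`
and affects nothing to its left. -/
theorem RightPermutive.exists_iterate_eq {f : LocalRule} (hf : RightPermutive f) (x v : Config)
    (a : ℤ) (n L : ℕ) : ∃ y : Config, (∀ i < a, y i = x i) ∧
      ∀ i, a - n ≤ i → i < a - n + L → (globalMap f)^[n] y i = v i := by
  induction L with
  | zero => exact ⟨x, fun _ _ => rfl, fun i h1 h2 => by push_cast at h2; omega⟩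
  | succ L ih =>
    obtain ⟨y, hyx, hyv⟩ := ih
    by_cases hv : (globalMap f)^[n] y (a + L - n) = v (a + L - n)
    · refine ⟨y, hyx, fun i h1 h2 => ?_⟩
      push_cast at h2
      rcases eq_or_ne i (a + L - n) with rfl | hi
      · exact hv
      · exact hyv i h1 (by omega)
    · refine ⟨toggle y (a + L), fun i hi => ?_, fun i h1 h2 => ?_⟩
      · rw [toggle_of_ne y (by omega), hyx i hi]
      · push_cast at h2
        rcases eq_or_ne i (a + L - n) with rfl | hi
        · have := hf.iterate_toggle y (a + L) n
          revert hv this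
          cases (globalMap f)^[n] y (a + L - n) <;> cases v (a + L - n) <;>
            cases (globalMap f)^[n] (toggle y (a + L)) (a + L - n) <;> simp
        · rw [← hyv i h1 (by omega)]
          exact iterate_eq_of_lt f (fun j hj => toggle_of_ne y hj.ne) n i (by omega)

theorem RightPermutive.isTransitiveMap {f : LocalRule} (hf : RightPermutive f) :
    IsTransitiveMap (globalMap f) := by
  rintro U V hU hV ⟨u, hu⟩ ⟨v, hv⟩
  obtain ⟨m, hm⟩ := exists_agree_subset hU hu
  obtain ⟨l, hl⟩ := exists_agree_subset hV hv
  -- The time `m + 1 + l` makes the prescribed stretch start at `-l`.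
  obtain ⟨y, hyu, hyv⟩ := hf.exists_iterate_eq u v (m + 1) (m + 1 + l) (2 * l + 1)
  exact ⟨m + 1 + l, by omega, _, ⟨y, hm y fun i hi => hyu i (by omega), rfl⟩,
    hl _ fun i hi => hyv i (by push_cast; omega) (by push_cast; omega)⟩

/-! ### Periodic points of right permutive rules

The cell `i` at time `n` is read in the slanted coordinates `(i - 2 * n, n)`. There three
consecutive columns determine all the others, to the right and to the left, and this keeps columns
that are periodic in time periodic. -/

/-- The step from three consecutive columns of period `k` to the next three. -/
def columnStep (f : LocalRule) (k : ℕ) :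
    Equiv.Perm ((ZMod k → Bool) × (ZMod k → Bool) × (ZMod k → Bool)) where
  toFun s := (s.2.1, s.2.2, fun t => xor (s.1 (t + 1)) (f (s.2.1 t) (s.2.2 t) false))
  invFun s :=
    (fun t => xor (s.2.2 (t - 1)) (f (s.1 (t - 1)) (s.2.1 (t - 1)) false), s.1, s.2.1)
  left_inv s := by simp
  right_inv s := by simp

/-- The column of index `i` generated by three consecutive columns. -/
def column (f : LocalRule) {k : ℕ} (D : (ZMod k → Bool) × (ZMod k → Bool) × (ZMod k → Bool))
    (i : ℤ) : ZMod k → Bool := ((columnStep f k ^ i) D).1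

theorem columnStep_zpow_succ (f : LocalRule) {k : ℕ}
    (D : (ZMod k → Bool) × (ZMod k → Bool) × (ZMod k → Bool)) (i : ℤ) :
    (columnStep f k ^ (i + 1)) D = columnStep f k ((columnStep f k ^ i) D) := by
  rw [add_comm, zpow_one_add, Equiv.Perm.mul_apply]

theorem column_add_three (f : LocalRule) {k : ℕ}
    (D : (ZMod k → Bool) × (ZMod k → Bool) × (ZMod k → Bool)) (i : ℤ) (t : ZMod k) :
    column f D (i + 3) t =
      xor (column f D i (t + 1)) (f (column f D (i + 1) t) (column f D (i + 2) t) false) := by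
  rw [show i + 3 = i + 1 + 1 + 1 by ring, show i + 2 = i + 1 + 1 by ring]
  simp only [column, columnStep_zpow_succ]
  rfl

/-- The configuration at time `n` of the orbit generated by three consecutive columns. -/
def slantedOrbit (f : LocalRule) {k : ℕ}
    (D : (ZMod k → Bool) × (ZMod k → Bool) × (ZMod k → Bool)) (n : ℕ) : Config :=
  fun i => column f D (i - 2 * n) n

theorem RightPermutive.globalMap_slantedOrbit {f : LocalRule} (hf : RightPermutive f) {k : ℕ}
    (D : (ZMod k → Bool) × (ZMod k → Bool) × (ZMod k → Bool)) (n : ℕ) :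
    globalMap f (slantedOrbit f D n) = slantedOrbit f D (n + 1) := by
  funext i
  have h := column_add_three f D (i - 2 * (n + 1)) n
  simp only [globalMap, slantedOrbit]
  rw [hf.apply]
  push_cast
  rw [show i + 1 - 2 * (n : ℤ) = i - 2 * (n + 1) + 3 by ring, h,
    show i - 1 - 2 * (n : ℤ) = i - 2 * (n + 1) + 1 by ring,
    show i - 2 * (n : ℤ) = i - 2 * (n + 1) + 2 by ring]
  simp

theorem RightPermutive.slantedOrbit_mem_periodicPts {f : LocalRule} (hf : RightPermutive f)
    {k : ℕ} [NeZero k] (D : (ZMod k → Bool) × (ZMod k → Bool) × (ZMod k → Bool)) :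
    slantedOrbit f D 0 ∈ Function.periodicPts (globalMap f) := by
  have hit (n : ℕ) : (globalMap f)^[n] (slantedOrbit f D 0) = slantedOrbit f D n := by
    induction n with
    | zero => rfl
    | succ n ih => rw [Function.iterate_succ_apply', ih, hf.globalMap_slantedOrbit]
  -- The factor `k` restores the time modulo `k`; the order cancels the column shift caused by the
  -- slant.
  refine ⟨k * orderOf (columnStep f k), Nat.mul_pos (NeZero.pos k) (orderOf_pos _), ?_⟩
  rw [Function.IsPeriodicPt, Function.IsFixedPt, hit]
  funext i
  have hpow : columnStep f k ^ (i - 2 * ((k * orderOf (columnStep f k) : ℕ) : ℤ)) =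
      columnStep f k ^ i := by
    rw [zpow_sub, ← Nat.cast_ofNat, ← Nat.cast_mul, zpow_natCast,
      show 2 * (k * orderOf (columnStep f k)) = orderOf (columnStep f k) * (2 * k) by ring,
      pow_mul, pow_orderOf_eq_one, one_pow, inv_one, mul_one]
  rw [slantedOrbit, column, hpow]
  simp [slantedOrbit, column]

/-- Three consecutive columns of the first `k` steps of an orbit, in slanted coordinates. -/
def orbitColumns (f : LocalRule) (k : ℕ) (y : Config) :
    (ZMod k → Bool) × (ZMod k → Bool) × (ZMod k → Bool) :=
  (fun t => (globalMap f)^[t.val] y (2 * t.val), fun t => (globalMap f)^[t.val] y (2 * t.val + 1),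
    fun t => (globalMap f)^[t.val] y (2 * t.val + 2))

/-- Column `i + 3` at time `t` uses column `i` at time `t + 1`, so each wrap-around error of the
periodized columns stays outside the triangle `i + t < k`. -/
theorem RightPermutive.column_orbitColumns {f : LocalRule} (hf : RightPermutive f) {k : ℕ}
    (y : Config) (i t : ℕ) (h : i + t < k) :
    column f (orbitColumns f k y) i t = (globalMap f)^[t] y (i + 2 * t) := by
  induction i using Nat.strong_induction_on generalizing t with
  | _ i ih =>
    have hval (h : t < k) : ((t : ℕ) : ZMod k).val = t := ZMod.val_cast_of_lt h
    match i, ih, h with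
    | 0, _, h =>
      simp [column, orbitColumns, hval (by omega)]
    | 1, _, h =>
      simp [column, orbitColumns, columnStep, hval (by omega), add_comm]
    | 2, _, h =>
      rw [column, show ((2 : ℕ) : ℤ) = 0 + 1 + 1 by norm_num, columnStep_zpow_succ,
        columnStep_zpow_succ]
      simp [orbitColumns, columnStep, hval (by omega), add_comm]
    | i + 3, ih, h =>
      have h0 := ih i (by omega) (t + 1) (by omega)
      have h1 := ih (i + 1) (by omega) t (by omega)
      have h2 := ih (i + 2) (by omega) t (by omega)
      push_cast at h0 h1 h2 ⊢
      rw [column_add_three, h0, h1, h2, Function.iterate_succ_apply', globalMap, hf.apply]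
      rw [show (i : ℤ) + 2 * (t + 1) + 1 = i + 3 + 2 * t by ring,
        show (i : ℤ) + 2 * (t + 1) - 1 = i + 1 + 2 * t by ring,
        show (i : ℤ) + 2 * (t + 1) = i + 2 + 2 * t by ring]
      simp

theorem RightPermutive.dense_periodicPts {f : LocalRule} (hf : RightPermutive f) :
    Dense (Function.periodicPts (globalMap f)) := by
  refine dense_iff_inter_open.2 fun U hU ⟨u, hu⟩ => ?_
  obtain ⟨m, hm⟩ := exists_agree_subset hU hu
  -- Translation moves the window to the cells `0, …, 2m`, inside the triangle at time 0; the power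
  -- `m` of the step undoes it.
  let y : Config := fun i => u (i - m)
  let D := orbitColumns f (2 * m + 1) y
  refine ⟨slantedOrbit f ((columnStep f (2 * m + 1) ^ (m : ℤ)) D) 0, hm _ fun i hi => ?_,
    hf.slantedOrbit_mem_periodicPts _⟩
  have h := hf.column_orbitColumns (k := 2 * m + 1) y (i + m).toNat 0 (by omega)
  rw [Int.toNat_of_nonneg (by omega)] at h
  simp only [slantedOrbit, column, ← Equiv.Perm.mul_apply, ← zpow_add]
  rw [Function.iterate_zero_apply] at h
  simpa [column, D, y] using h

theorem RightPermutive.isDevaneyChaotic {f : LocalRule} (hf : RightPermutive f) :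
    IsDevaneyChaotic (globalMap f) :=
  ⟨hf.isSensitive, hf.isTransitiveMap, hf.dense_periodicPts⟩

/-! ### Rules with an orphan, and rules that are isometries -/

/-- The possible states of the last two cells of a pattern whose image ends in the state `o`, where
`S` holds the possible states of these cells one step earlier. -/
def lastPairs (f : LocalRule) (S : Bool → Bool → Bool) (o : Bool) : Bool → Bool → Bool :=
  fun b c => (S false b && f false b c == o) || (S true b && f true b c == o)

/-- No pattern is mapped to the word `w`. -/
def IsOrphan (f : LocalRule) (w : List Bool) : Prop :=
  ∀ a b, w.foldl (lastPairs f) (fun _ _ => true) a b = false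

instance (f : LocalRule) (w : List Bool) : Decidable (IsOrphan f w) := by
  unfold IsOrphan; infer_instance

/-- Soundness of the subset construction: the last two cells of an actual preimage always stay among
the possible states. -/
theorem foldl_lastPairs (f : LocalRule) (x : Config) (w : List Bool) (S : Bool → Bool → Bool)
    (j : ℤ) (hS : S (x (j - 1)) (x j) = true)
    (hw : ∀ (i : ℕ) (hi : i < w.length), globalMap f x (j + i) = w[i]) :
    w.foldl (lastPairs f) S (x (j + w.length - 1)) (x (j + w.length)) = true := by
  induction w generalizing S j with
  | nil => simpa using hS
  | cons o w ih =>
    have h0 := hw 0 (by simp)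
    simp only [Nat.cast_zero, add_zero, List.getElem_cons_zero, globalMap] at h0
    have := ih (lastPairs f S o) (j + 1) (by
      rw [add_sub_cancel_right, ← h0, lastPairs]
      revert hS
      cases x (j - 1) <;> simp +contextual) (fun i hi => by
        have := hw (i + 1) (by simpa using hi)
        rw [List.getElem_cons_succ] at this
        rw [← this]
        push_cast
        congr 1
        ring)
    rw [List.foldl_cons, List.length_cons]
    push_cast
    rwa [← add_assoc, add_right_comm]

theorem IsOrphan.not_isTransitiveMap {f : LocalRule} {w : List Bool} (hw : IsOrphan f w) :
    ¬ IsTransitiveMap (globalMap f) := by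
  intro h
  -- Only the cells carrying `w` matter; the values elsewhere are arbitrary.
  let v : Config := fun i => w.getD i.toNat false
  obtain ⟨n, hn, _, ⟨x, -, rfl⟩, hx⟩ := h Set.univ _ isOpen_univ (isOpen_agree v w.length)
    ⟨v, trivial⟩ ⟨v, fun _ _ => rfl⟩
  obtain ⟨n, rfl⟩ := Nat.exists_eq_succ_of_ne_zero hn.ne'
  rw [Function.iterate_succ_apply'] at hx
  have := foldl_lastPairs f ((globalMap f)^[n] x) w (fun _ _ => true) 0 rfl fun i hi => by
    rw [hx (0 + i) (by omega)]
    simp [v, hi]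
  rw [hw] at this
  exact absurd this (by simp)

theorem not_isSensitive_of_center {f : LocalRule} {s : Bool} (hf : ∀ a b c, f a b c = xor s b) :
    ¬ IsSensitive (globalMap f) := by
  rintro ⟨ε, hε, h⟩
  have hdist (x y : Config) : dist (globalMap f x) (globalMap f y) = dist x y := by
    rw [dist_def, dist_def]
    refine tsum_congr fun i => ?_
    simp [globalMap, hf]
  obtain ⟨y, hy, n, hn⟩ := h (fun _ => false) ε hε
  have hiso (m : ℕ) (x y : Config) :
      dist ((globalMap f)^[m] x) ((globalMap f)^[m] y) = dist x y := by
    induction m with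
    | zero => rfl
    | succ m ih => rw [Function.iterate_succ_apply', Function.iterate_succ_apply', hdist, ih]
  exact absurd hy (not_lt.2 (hn.trans_eq (hiso n _ y)))

/-! ### The case distinction -/

instance (f : LocalRule) : Decidable (RightPermutive f) := by
  unfold RightPermutive; infer_instance

/-- The rule with the given table of values. -/
def ofTable (v₀ v₁ v₂ v₃ v₄ v₅ v₆ v₇ : Bool) : LocalRule := fun a b c =>
  bif a then bif b then bif c then v₇ else v₆ else bif c then v₅ else v₄
  else bif b then bif c then v₃ else v₂ else bif c then v₁ else v₀

/-- Turns a statement on all rules into one on eight Booleans, which the kernel can decide. -/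
theorem forall_localRule {P : LocalRule → Prop}
    (h : ∀ v₀ v₁ v₂ v₃ v₄ v₅ v₆ v₇, P (ofTable v₀ v₁ v₂ v₃ v₄ v₅ v₆ v₇)) (f : LocalRule) :
    P f := by
  convert h (f false false false) (f false false true) (f false true false) (f false true true)
    (f true false false) (f true false true) (f true true false) (f true true true)
  funext a b c
  cases a <;> cases b <;> cases c <;> rfl

theorem permutive_of_classNumber_mem (f : LocalRule) :
    classNumber f ∈ ({15, 30, 45, 60, 90, 105, 106, 150, 154, 170} : Finset ℕ) →
      RightPermutive f ∨ RightPermutive (reflect f) :=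
  forall_localRule (P := fun f =>
    classNumber f ∈ ({15, 30, 45, 60, 90, 105, 106, 150, 154, 170} : Finset ℕ) →
      RightPermutive f ∨ RightPermutive (reflect f)) (by decide +kernel) f

/-- Words such that each rule that is not surjective has one of them as an orphan. -/
def orphanWords : List (List Bool) :=
  [[false, false, false, true, false, true, false, true, true, true],
   [true, true, true, false, false, true, false, false, false, false],
   [false, false, false, true, true, false, true, true, true, true],
   [false, true, false, true, true, false, false, true, false, true]]

theorem classNumber_mem_or (f : LocalRule) :
    classNumber f ∈ ({15, 30, 45, 60, 90, 105, 106, 150, 154, 170} : Finset ℕ) ∨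
      (∃ w ∈ orphanWords, IsOrphan f w) ∨ ∃ s, ∀ a b c, f a b c = xor s b :=
  forall_localRule (P := fun f =>
    classNumber f ∈ ({15, 30, 45, 60, 90, 105, 106, 150, 154, 170} : Finset ℕ) ∨
      (∃ w ∈ orphanWords, IsOrphan f w) ∨ ∃ s, ∀ a b c, f a b c = xor s b) (by decide +kernel) f

end ECA

theorem mainTheorem8 (f : ECA.LocalRule) :
    IsDevaneyChaotic (ECA.globalMap f) ↔
      ECA.classNumber f ∈ ({15, 30, 45, 60, 90, 105, 106, 150, 154, 170} : Finset ℕ) := by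
  constructor
  · rintro ⟨hs, ht, -⟩
    rcases ECA.classNumber_mem_or f with h | ⟨w, -, hw⟩ | ⟨s, h⟩
    · exact h
    · exact absurd ht hw.not_isTransitiveMap
    · exact absurd hs (ECA.not_isSensitive_of_center h)
  · intro h
    rcases ECA.permutive_of_classNumber_mem f h with hf | hf
    · exact hf.isDevaneyChaotic
    · exact ECA.isDevaneyChaotic_of_reflect hf.isDevaneyChaotic
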